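/- Let $X\in\mathbb R^{n\times p}$ have rank $p$, let $Y\in\mathbb R^{n\times M}$, let $\lambda\ge 0$, $\rho>0$, and let $G$ be an undirected simple graph with vertices $1,\dots,M$ and edges $e_1,\dots,e_m$. Let $D\in\mathbb R^{M\times m}$ be its incidence matrix: if $e_j=\{i_1,i_2\}$ with $i_1<i_2$, then $D_{i_1,j}=1$, $D_{i_2,j}=-1$, and the other entries of column $j$ vanish. Put $D_v=I_n\otimes D$, $H_v=\bigl(X(X^TX)^{-1}X^T\bigr)\otimes I_M$ and $y=\mathrm{vec}(Y^T)\in\mathbb R^{nM}$. Then the problem $$\text{(CP)}\qquad \min_{\theta\in\mathbb R^{nM}}\ \tfrac12\|y-\theta\|_2^2+\lambda\|D_v^T\theta\|_1\quad\text{subject to}\quad (I-H_v)\theta=0$$ has a unique global optimum $\hat\theta$. For arbitrary $\theta^{(0)},\eta^{(0)},\mu^{(0)}\in\mathbb R^{nM}$ and $U^{(0)}=V^{(0)}=0$, consider the three-block ADMM $$\begin{aligned} \theta^{(k+1)}&=\frac{y+\rho(\eta^{(k)}-U^{(k)}+\mu^{(k)}-V^{(k)})}{2\rho+1},\\ \eta^{(k+1)}&=H_v(\theta^{(k+1)}+U^{(k)}),\\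 \mu^{(k+1)}&=\arg\min_{\mu}\ \lambda\|D_v^T\mu\|_1+\tfrac{\rho}{2}\|\theta^{(k+1)}+V^{(k)}-\mu\|_2^2,\\ U^{(k+1)}&=U^{(k)}+\theta^{(k+1)}-\eta^{(k+1)},\\ V^{(k+1)}&=V^{(k)}+\theta^{(k+1)}-\mu^{(k+1)}. \end{aligned}$$ These iterates are well defined (every $\arg\min$ exists and is unique), and they converge linearly to $\hat\theta$: there is a $q\in(0,1)$, independent of the initialization, such that for every initialization there is a constant $C$ with $$\max\bigl\{\|\theta^{(k)}-\hat\theta\|_2,\ \|\eta^{(k)}-\hat\theta\|_2,\ \|\mu^{(k)}-\hat\theta\|_2\bigr\}\le C\,q^k\qquad\text{for all }k\ge 0.$$ -/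

import Mathlib

open scoped Kronecker Matrix

/-- Euclidean (Frobenius) norm of a real vector indexed by a finite type. -/
noncomputable def l2norm {ι : Type*} [Fintype ι] (x : ι → ℝ) : ℝ :=
  Real.sqrt (∑ i, x i ^ 2)

/-- The `ℓ₁` norm of a real vector indexed by a finite type. -/
def l1norm {ι : Type*} [Fintype ι] (x : ι → ℝ) : ℝ :=
  ∑ i, |x i|

/-- Incidence matrix of a graph on the vertices `Fin M` whose edges are enumerated by `e`:
the column of an edge `{i₁, i₂}`, `i₁ < i₂`, is `1` at `i₁`, `-1` at `i₂` and `0` elsewhere. -/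
def incidence {M m : ℕ} {G : SimpleGraph (Fin M)} (e : Fin m ≃ G.edgeSet) :
    Matrix (Fin M) (Fin m) ℝ :=
  Matrix.of fun i j =>
    if i = (e j : Sym2 (Fin M)).inf then 1
    else if i = (e j : Sym2 (Fin M)).sup then -1
    else 0

/-- Extended incidence matrix `D_v = I_n ⊗ D`. -/
def extIncidence (n : ℕ) {M m : ℕ} {G : SimpleGraph (Fin M)} (e : Fin m ≃ G.edgeSet) :
    Matrix (Fin n × Fin M) (Fin n × Fin m) ℝ :=
  (1 : Matrix (Fin n) (Fin n) ℝ) ⊗ₖ incidence e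

/-- Hat matrix `H = X (Xᵀ X)⁻¹ Xᵀ`. -/
noncomputable def hat {n p : ℕ} (X : Matrix (Fin n) (Fin p) ℝ) : Matrix (Fin n) (Fin n) ℝ :=
  X * (Xᵀ * X)⁻¹ * Xᵀ

/-- Extended hat matrix `H_v = H ⊗ I_M`. -/
noncomputable def extHat {n p : ℕ} (M : ℕ) (X : Matrix (Fin n) (Fin p) ℝ) :
    Matrix (Fin n × Fin M) (Fin n × Fin M) ℝ :=
  hat X ⊗ₖ (1 : Matrix (Fin M) (Fin M) ℝ)

/-- Objective of the constrained problem, `½ ‖vec(Yᵀ) - θ‖² + λ ‖D_vᵀ θ‖₁`. -/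
noncomputable def objCP {n M m : ℕ} (Y : Matrix (Fin n) (Fin M) ℝ) {G : SimpleGraph (Fin M)}
    (e : Fin m ≃ G.edgeSet) (lam : ℝ) (θ : Fin n × Fin M → ℝ) : ℝ :=
  1 / 2 * l2norm (Yᵀ.vec - θ) ^ 2 + lam * l1norm ((extIncidence n e)ᵀ *ᵥ θ)

/-- Feasible set of the constrained problem, `(I - H_v) θ = 0`. -/
def feasibleCP {n p : ℕ} (M : ℕ) (X : Matrix (Fin n) (Fin p) ℝ) : Set (Fin n × Fin M → ℝ) :=
  {θ | (1 - extHat M X) *ᵥ θ = 0}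

/-- `θ` is a global optimum of the constrained problem. -/
def IsOptimumCP {n p M m : ℕ} (X : Matrix (Fin n) (Fin p) ℝ) (Y : Matrix (Fin n) (Fin M) ℝ)
    {G : SimpleGraph (Fin M)} (e : Fin m ≃ G.edgeSet) (lam : ℝ)
    (θ : Fin n × Fin M → ℝ) : Prop :=
  θ ∈ feasibleCP M X ∧ IsMinOn (objCP Y e lam) (feasibleCP M X) θ

/-- The variables of the ADMM: primal `θ, η, μ` and scaled dual `U, V`. -/
@[ext] structure ADMMState (n M : ℕ) where
  θ : Fin n × Fin M → ℝ
  η : Fin n × Fin M → ℝ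
  μ : Fin n × Fin M → ℝ
  U : Fin n × Fin M → ℝ
  V : Fin n × Fin M → ℝ

/-- Objective of the graph-fused lasso step, `λ ‖D_vᵀ μ‖₁ + (ρ/2) ‖w - μ‖²`. -/
noncomputable def objGFL {n M m : ℕ} {G : SimpleGraph (Fin M)} (e : Fin m ≃ G.edgeSet)
    (lam ρ : ℝ) (w μ : Fin n × Fin M → ℝ) : ℝ :=
  lam * l1norm ((extIncidence n e)ᵀ *ᵥ μ) + ρ / 2 * l2norm (w - μ) ^ 2

/-- One pass `s ↦ t` through the loop of the ADMM. -/
structure ADMMStep {n p M m : ℕ} (X : Matrix (Fin n) (Fin p) ℝ) (Y : Matrix (Fin n) (Fin M) ℝ)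
    {G : SimpleGraph (Fin M)} (e : Fin m ≃ G.edgeSet) (lam ρ : ℝ) (s t : ADMMState n M) :
    Prop where
  theta_eq : t.θ = (2 * ρ + 1)⁻¹ • (Yᵀ.vec + ρ • (s.η - s.U + s.μ - s.V))
  eta_eq : t.η = extHat M X *ᵥ (t.θ + s.U)
  mu_isMin : IsMinOn (objGFL e lam ρ (t.θ + s.V)) Set.univ t.μ
  U_eq : t.U = s.U + t.θ - t.η
  V_eq : t.V = s.V + t.θ - t.μ

/-- `s` is the sequence of iterates of the ADMM started at `(θ₀, η₀, μ₀)`, with zero duals. -/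
structure IsADMMRun {n p M m : ℕ} (X : Matrix (Fin n) (Fin p) ℝ) (Y : Matrix (Fin n) (Fin M) ℝ)
    {G : SimpleGraph (Fin M)} (e : Fin m ≃ G.edgeSet) (lam ρ : ℝ)
    (θ₀ η₀ μ₀ : Fin n × Fin M → ℝ) (s : ℕ → ADMMState n M) : Prop where
  init : s 0 = ⟨θ₀, η₀, μ₀, 0, 0⟩
  step : ∀ k, ADMMStep X Y e lam ρ (s k) (s (k + 1))

/-!
The argument takes place in the Euclidean space of `vec(Yᵀ)`, with the columns `a j` of the extended
incidence matrix and the orthogonal projection `P` given by the extended hat matrix. Both (CP) and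
the graph-fused lasso step minimise `(c / 2) ‖y - x‖² + lam ∑ⱼ |⟪aⱼ, x⟫|` on a subspace. This
function is coercive and strongly convex, so a minimiser exists and is unique, and it is
characterised by a subgradient of the `ℓ₁` norm (`exists_isL1Subgrad_of_isMinOn`,
`fusedObjective_add_le`).

For the iterates, consider `w = (η + U, μ + V)`. The fixed points of the iteration in terms of `w`
are `(θhat + u, θhat + v)`, where `(u, v)` certifies optimality of `θhat`. One pass brings `w` closer
to each of them: the squared distance drops at least by
`‖θ - η‖² + ‖θ - μ‖² + (2 / ρ) ‖θ - θhat‖²` (`admm_fejer`). Hence this residual tends to `0` and `μ`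
tends to `θhat`, and eventually the subdifferential at `μ` is contained in the subdifferential at
`θhat`, which is a box. From then on Hoffman's error bound for boxes
(`exists_hoffman_bound_between`) shows that the squared distance from `w` to the *set* of fixed
points is at most a constant times the residual (`exists_dualSolutions_error_bound`). So that
squared distance contracts by a fixed factor, and it dominates the primal errors. The Hoffman
constant depends only on the vectors `a j` and on `P`, whence a rate independent of the
initialization.
-/

open Filter Topology

/-! ### Hoffman's error bound for boxes -/

/-- A vector `d` can be shrunk, coordinatewise towards `0` and without changing `B d`, until no nonzero
kernel vector of `B` lies in the cone of vectors that vanish where `d'` does and have nowhere the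
opposite sign: as long as such a kernel vector exists, subtracting a multiple of it makes one more
coordinate vanish. -/
theorem exists_conformal_reduction {J F : Type*} [Fintype J] [AddCommGroup F] [Module ℝ F]
    (B : (J → ℝ) →ₗ[ℝ] F) (d : J → ℝ) :
    ∃ d' : J → ℝ, (∀ j, d' j ∈ Set.uIcc 0 (d j)) ∧ B d' = B d ∧
      ∀ z : J → ℝ, B z = 0 → (∀ j, d' j = 0 → z j = 0) → (∀ j, 0 ≤ d' j * z j) → z = 0 := by
  classical
  induction hN : (Finset.univ.filter fun j => d j ≠ 0).card using Nat.strong_induction_on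
    generalizing d with
  | _ N ih =>
  by_cases hd : ∀ z : J → ℝ, B z = 0 → (∀ j, d j = 0 → z j = 0) → (∀ j, 0 ≤ d j * z j) → z = 0
  · exact ⟨d, fun j => Set.right_mem_uIcc, rfl, hd⟩
  push Not at hd
  obtain ⟨z, hBz, hz0, hzd, hz⟩ := hd
  have hne : (Finset.univ.filter fun j => z j ≠ 0).Nonempty := by
    obtain ⟨j, hj⟩ := Function.ne_iff.1 hz
    exact ⟨j, by simpa using hj⟩
  obtain ⟨i, hi, hmin⟩ := Finset.exists_min_image _ (fun j => d j / z j) hne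
  replace hi : z i ≠ 0 := by simpa using hi
  have hratio : ∀ j, 0 ≤ d j / z j := fun j => by
    rw [div_nonneg_iff]
    exact (mul_nonneg_iff.1 (hzd j))
  -- Subtract the largest multiple of `z` that does not reverse the sign of a coordinate of `d`.
  set τ := d i / z i with hτ
  have hcoord : ∀ j, ∃ c : ℝ, 0 ≤ c ∧ c ≤ 1 ∧ d j - τ * z j = c * d j := by
    intro j
    by_cases hzj : z j = 0
    · exact ⟨1, zero_le_one, le_rfl, by simp [hzj]⟩
    · have hdj : d j ≠ 0 := fun h => hzj (hz0 j h)
      have h1 : τ ≤ d j / z j := hmin j (by simpa using hzj)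
      have hpos : 0 < d j / z j := lt_of_le_of_ne (hratio j) (div_ne_zero hdj hzj).symm
      refine ⟨1 - τ / (d j / z j), sub_nonneg.2 ((div_le_one hpos).2 h1),
        sub_le_self _ (div_nonneg (hratio i) hpos.le), ?_⟩
      field_simp
  have hcard : (Finset.univ.filter fun j => (d - τ • z) j ≠ 0).card < N := by
    rw [← hN]
    apply Finset.card_lt_card
    refine ⟨fun j => ?_, fun h => ?_⟩
    · simp only [Finset.mem_filter, Finset.mem_univ, true_and, Pi.sub_apply, Pi.smul_apply,
        smul_eq_mul]
      intro h hdj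
      obtain ⟨c, -, -, hc⟩ := hcoord j
      exact h (by rw [hc, hdj, mul_zero])
    · have hdi : d i ≠ 0 := fun h => hi (hz0 i h)
      have := h (Finset.mem_filter.2 ⟨Finset.mem_univ i, hdi⟩)
      simp [hτ, div_mul_cancel₀ _ hi] at this
  obtain ⟨d', hd', hB, hcone⟩ := ih _ hcard (d - τ • z) rfl
  refine ⟨d', fun j => ?_, by rw [hB, map_sub, map_smul, hBz, smul_zero, sub_zero], hcone⟩
  refine Set.uIcc_subset_uIcc_left ?_ (hd' j)
  obtain ⟨c, hc0, hc1, hc⟩ := hcoord j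
  simp only [Pi.sub_apply, Pi.smul_apply, smul_eq_mul, hc]
  rw [Set.mem_uIcc]
  rcases le_total 0 (d j) with h | h
  · exact Or.inl ⟨mul_nonneg hc0 h, mul_le_of_le_one_left h hc1⟩
  · exact Or.inr ⟨by nlinarith, mul_nonpos_of_nonneg_of_nonpos hc0 h⟩

/-- If the kernel of `B` meets the closed cone of a sign pattern only in `0`, then `B` is bounded below
on that cone, by compactness of its intersection with the unit sphere. -/
theorem exists_norm_le_of_sign_cone {J F : Type*} [Fintype J] [NormedAddCommGroup F]
    [NormedSpace ℝ F] (B : (J → ℝ) →ₗ[ℝ] F) (d : J → SignType)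
    (hd : ∀ z : J → ℝ, B z = 0 → (∀ j, d j = 0 → z j = 0) → (∀ j, 0 ≤ (d j : ℝ) * z j) → z = 0) :
    ∃ κ : ℝ, 0 ≤ κ ∧ ∀ z : J → ℝ, (∀ j, d j = 0 → z j = 0) → (∀ j, 0 ≤ (d j : ℝ) * z j) →
      ‖z‖ ≤ κ * ‖B z‖ := by
  have hBc : Continuous B := B.continuous_of_finiteDimensional
  let K : Set (J → ℝ) := {z | (∀ j, d j = 0 → z j = 0) ∧ ∀ j, 0 ≤ (d j : ℝ) * z j}
  have hK : IsClosed K := by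
    have : K = (⋂ j, ⋂ _ : d j = 0, {z | z j = 0}) ∩ ⋂ j, {z | 0 ≤ (d j : ℝ) * z j} := by
      ext z; simp [K]
    rw [this]
    refine IsClosed.inter (isClosed_iInter fun j => isClosed_iInter fun _ => ?_)
      (isClosed_iInter fun j => ?_)
    · exact isClosed_eq (continuous_apply j) continuous_const
    · exact isClosed_le continuous_const (continuous_const.mul (continuous_apply j))
  have hcomp : IsCompact (Metric.sphere (0 : J → ℝ) 1 ∩ K) := (isCompact_sphere _ _).inter_right hK
  have hscale : ∀ z : J → ℝ, z ∈ K → z ≠ 0 → ‖z‖⁻¹ • z ∈ Metric.sphere (0 : J → ℝ) 1 ∩ K := by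
    intro z hz hz0
    refine ⟨by simp [norm_smul, norm_ne_zero_iff.2 hz0], fun j hj => by simp [hz.1 j hj],
      fun j => ?_⟩
    have := mul_nonneg (inv_nonneg.2 (norm_nonneg z)) (hz.2 j)
    simpa [mul_left_comm] using this
  rcases (Metric.sphere (0 : J → ℝ) 1 ∩ K).eq_empty_or_nonempty with he | hne
  · refine ⟨0, le_rfl, fun z h1 h2 => ?_⟩
    by_cases hz : z = 0
    · simp [hz]
    · exact absurd (hscale z ⟨h1, h2⟩ hz) (by simp [he])
  · obtain ⟨x, hx, hmin⟩ := hcomp.exists_isMinOn hne hBc.norm.continuousOn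
    have hBx : 0 < ‖B x‖ := by
      rw [norm_pos_iff]
      intro h
      have := hd x h hx.2.1 hx.2.2
      have h1 := hx.1
      simp [this] at h1
    refine ⟨‖B x‖⁻¹, (inv_pos.2 hBx).le, fun z h1 h2 => ?_⟩
    by_cases hz : z = 0
    · simp [hz]
    · have h3 : ‖B x‖ ≤ ‖B (‖z‖⁻¹ • z)‖ := hmin (hscale z ⟨h1, h2⟩ hz)
      have hzpos := norm_pos_iff.2 hz
      rw [map_smul, norm_smul, norm_inv, norm_norm] at h3
      rw [inv_mul_eq_div, le_div_iff₀ hBx]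
      calc ‖z‖ * ‖B x‖ ≤ ‖z‖ * (‖z‖⁻¹ * ‖B z‖) := by gcongr
        _ = ‖B z‖ := by field_simp

/-- Hoffman's error bound for boxes. The solution `t'` of `B t' = B t` close to `s` lies coordinatewise
between `s` and `t`, so it belongs to every box that contains `s` and `t`, and `κ` is independent of
the box. It is the sum of the bounds for the finitely many sign patterns of the reduction of
`t - s`. -/
theorem exists_hoffman_bound_between {J F : Type*} [Fintype J] [NormedAddCommGroup F]
    [NormedSpace ℝ F] (B : (J → ℝ) →ₗ[ℝ] F) :
    ∃ κ : ℝ, 0 ≤ κ ∧ ∀ s t : J → ℝ, ∃ t' : J → ℝ, (∀ j, t' j ∈ Set.uIcc (s j) (t j)) ∧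
      B t' = B t ∧ ‖t' - s‖ ≤ κ * ‖B t - B s‖ := by
  classical
  have hκ : ∀ σ : J → SignType, ∃ κ : ℝ, 0 ≤ κ ∧
      ((∀ z : J → ℝ, B z = 0 → (∀ j, σ j = 0 → z j = 0) → (∀ j, 0 ≤ (σ j : ℝ) * z j) → z = 0) →
      ∀ z : J → ℝ, (∀ j, σ j = 0 → z j = 0) → (∀ j, 0 ≤ (σ j : ℝ) * z j) →
        ‖z‖ ≤ κ * ‖B z‖) := by
    intro σ
    by_cases h : ∀ z : J → ℝ, B z = 0 → (∀ j, σ j = 0 → z j = 0) →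
        (∀ j, 0 ≤ (σ j : ℝ) * z j) → z = 0
    · obtain ⟨κ, h0, h1⟩ := exists_norm_le_of_sign_cone B σ h
      exact ⟨κ, h0, fun _ => h1⟩
    · exact ⟨0, le_rfl, fun h' => absurd h' h⟩
  choose κ hκ0 hκ using hκ
  refine ⟨∑ σ, κ σ, Finset.sum_nonneg fun σ _ => hκ0 σ, fun s t => ?_⟩
  obtain ⟨d, hd, hB, hcone⟩ := exists_conformal_reduction B (t - s)
  have hsign : ∀ (x z : ℝ), 0 ≤ ((SignType.sign x : SignType) : ℝ) * z ↔ 0 ≤ x * z := by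
    intro x z
    rcases lt_trichotomy x 0 with h | h | h
    · simp [sign_neg h, mul_nonneg_iff, h.not_ge, h.le]
    · simp [h]
    · simp [sign_pos h, h]
  have hbound := hκ (fun j => SignType.sign (d j))
    (fun z h1 h2 h3 => hcone z h1 (fun j hj => h2 j (by simp [hj]))
      fun j => (hsign _ _).1 (h3 j)) d (fun j hj => by simpa using hj)
    (fun j => (hsign _ _).2 (mul_self_nonneg _))
  refine ⟨s + d, fun j => ?_, by rw [map_add, hB, map_sub]; abel, ?_⟩
  · have := hd j
    simp only [Set.mem_uIcc, Pi.sub_apply, Pi.add_apply] at this ⊢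
    rcases this with ⟨h1, h2⟩ | ⟨h1, h2⟩
    · exact Or.inl ⟨by linarith, by linarith⟩
    · exact Or.inr ⟨by linarith, by linarith⟩
  · rw [add_sub_cancel_left, ← map_sub, ← hB]
    refine hbound.trans (mul_le_mul_of_nonneg_right ?_ (norm_nonneg _))
    exact Finset.single_le_sum (f := κ) (fun σ _ => hκ0 σ) (Finset.mem_univ _)

/-! ### Subgradients of the `ℓ₁` norm -/

/-- `s` is a subgradient at `z` of `lam` times the `ℓ₁` norm, characterised coordinatewise:
`s j` is `lam` times the sign of `z j` if `z j ≠ 0`, and lies in `[-lam, lam]` if `z j = 0`. -/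
structure IsL1Subgrad {J : Type*} (lam : ℝ) (z s : J → ℝ) : Prop where
  abs_apply_le : ∀ j, |s j| ≤ lam
  mul_eq : ∀ j, s j * z j = lam * |z j|

namespace IsL1Subgrad

variable {J : Type*} {lam : ℝ} {z z' s s' t : J → ℝ}

theorem mul_le (hs : IsL1Subgrad lam z s) (z' : J → ℝ) (j : J) : s j * z' j ≤ lam * |z' j| :=
  (le_abs_self _).trans (by
    rw [abs_mul]; exact mul_le_mul_of_nonneg_right (hs.abs_apply_le j) (abs_nonneg _))

/-- The subgradient inequality. -/
theorem sum_mul_sub_le [Fintype J] (hs : IsL1Subgrad lam z s) (z' : J → ℝ) :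
    ∑ j, s j * (z' j - z j) ≤ lam * ∑ j, |z' j| - lam * ∑ j, |z j| := by
  rw [Finset.mul_sum, Finset.mul_sum, ← Finset.sum_sub_distrib]
  exact Finset.sum_le_sum fun j _ => by linarith [hs.mul_le z' j, hs.mul_eq j]

theorem monotone [Fintype J] (hs : IsL1Subgrad lam z s) (hs' : IsL1Subgrad lam z' s') :
    0 ≤ ∑ j, (s j - s' j) * (z j - z' j) :=
  Finset.sum_nonneg fun j _ => by
    linarith [hs.mul_le z' j, hs.mul_eq j, hs'.mul_le z j, hs'.mul_eq j]

theorem of_mem_uIcc (hs : IsL1Subgrad lam z s) (hs' : IsL1Subgrad lam z s')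
    (ht : ∀ j, t j ∈ Set.uIcc (s j) (s' j)) : IsL1Subgrad lam z t := by
  have key : ∀ j, |t j| ≤ lam ∧ t j * z j = lam * |z j| := fun j => by
    obtain ⟨a, b, ha, hb, hab, h⟩ := (segment_eq_uIcc (s j) (s' j)).symm ▸ ht j
    have h1 := abs_le.1 (hs.abs_apply_le j)
    have h2 := abs_le.1 (hs'.abs_apply_le j)
    simp only [smul_eq_mul] at h
    refine ⟨abs_le.2 ⟨?_, ?_⟩, ?_⟩
    · rw [← h]
      linarith [mul_le_mul_of_nonneg_left h1.1 ha, mul_le_mul_of_nonneg_left h2.1 hb,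
        congrArg (· * lam) hab]
    · rw [← h]
      linarith [mul_le_mul_of_nonneg_left h1.2 ha, mul_le_mul_of_nonneg_left h2.2 hb,
        congrArg (· * lam) hab]
    · rw [← h]
      linear_combination a * hs.mul_eq j + b * hs'.mul_eq j + lam * |z j| * hab
  exact ⟨fun j => (key j).1, fun j => (key j).2⟩

/-- The subdifferential of the `ℓ₁` norm can only shrink on passing from `z` to a nearby point, since
nonzero coordinates of `z` keep their signs. -/
theorem eventually_of_near [Finite J] (lam : ℝ) (z : J → ℝ) :
    ∀ᶠ z' in 𝓝 z, ∀ s : J → ℝ, IsL1Subgrad lam z' s → IsL1Subgrad lam z s := by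
  have h : ∀ᶠ z' in 𝓝 z, ∀ j, z j ≠ 0 → 0 < z' j * z j := by
    rw [eventually_all]
    intro j
    by_cases hj : z j = 0
    · simp [hj]
    · have : Tendsto (fun z' : J → ℝ => z' j * z j) (𝓝 z) (𝓝 (z j * z j)) :=
        ((continuous_apply j).mul continuous_const).tendsto z
      filter_upwards [this.eventually_const_lt (mul_self_pos.2 hj)] with z' hz' _ using hz'
  filter_upwards [h] with z' hz' s hs
  refine ⟨hs.abs_apply_le, fun j => ?_⟩
  by_cases hj : z j = 0
  · simp [hj]
  · have h1 := hs.mul_eq j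
    rcases pos_and_pos_or_neg_and_neg_of_mul_pos (hz' j hj) with ⟨h2, h3⟩ | ⟨h2, h3⟩
    · rw [abs_of_pos h2] at h1
      rw [abs_of_pos h3, mul_right_cancel₀ h2.ne' h1]
    · rw [abs_of_neg h2] at h1
      rw [abs_of_neg h3]
      have : s j = -lam := mul_right_cancel₀ h2.ne (by linarith)
      rw [this]; ring

end IsL1Subgrad

theorem isCompact_setOf_isL1Subgrad {J : Type*} [Fintype J] (lam : ℝ) (z : J → ℝ) :
    IsCompact {s : J → ℝ | IsL1Subgrad lam z s} := by
  have hc : IsClosed {s : J → ℝ | IsL1Subgrad lam z s} := by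
    have : {s : J → ℝ | IsL1Subgrad lam z s} =
        (⋂ j, {s | |s j| ≤ lam}) ∩ ⋂ j, {s | s j * z j = lam * |z j|} := by
      ext s
      simp only [Set.mem_inter_iff, Set.mem_iInter, Set.mem_ofPred_eq]
      exact ⟨fun h => ⟨h.1, h.2⟩, fun h => ⟨h.1, h.2⟩⟩
    rw [this]
    refine (isClosed_iInter fun j => ?_).inter (isClosed_iInter fun j => ?_)
    · exact isClosed_le (continuous_apply j).abs continuous_const
    · exact isClosed_eq ((continuous_apply j).mul continuous_const) continuous_const
  refine (isCompact_closedBall (0 : J → ℝ) |lam|).of_isClosed_subset hc fun s hs => ?_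
  rw [mem_closedBall_zero_iff, pi_norm_le_iff_of_nonneg (abs_nonneg _)]
  exact fun j => (hs.abs_apply_le j).trans (le_abs_self _)

theorem convex_setOf_isL1Subgrad {J : Type*} (lam : ℝ) (z : J → ℝ) :
    Convex ℝ {s : J → ℝ | IsL1Subgrad lam z s} := by
  intro s hs t ht a b ha hb hab
  refine hs.of_mem_uIcc ht fun j => ?_
  rw [← segment_eq_uIcc]
  exact ⟨a, b, ha, hb, hab, rfl⟩

/-- Along a ray, the `ℓ₁` norm is initially affine, and its slope is attained by a subgradient. -/
theorem exists_isL1Subgrad_directional {J : Type*} [Fintype J] {lam : ℝ} (hlam : 0 ≤ lam)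
    (z d : J → ℝ) : ∃ s, IsL1Subgrad lam z s ∧
      ∀ᶠ τ : ℝ in 𝓝[>] 0, lam * ∑ j, |z j + τ * d j| =
        lam * ∑ j, |z j| + τ * ∑ j, s j * d j := by
  have key : ∀ j, ∃ r : ℝ, |r| ≤ lam ∧ r * z j = lam * |z j| ∧
      ∀ᶠ τ : ℝ in 𝓝[>] 0, lam * |z j + τ * d j| = lam * |z j| + τ * (r * d j) := by
    intro j
    have hlim : Tendsto (fun τ : ℝ => z j + τ * d j) (𝓝[>] 0) (𝓝 (z j)) := by
      have : Continuous fun τ : ℝ => z j + τ * d j := by fun_prop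
      simpa using (this.tendsto 0).mono_left nhdsWithin_le_nhds
    rcases lt_trichotomy (z j) 0 with h | h | h
    · refine ⟨-lam, by rw [abs_neg, abs_of_nonneg hlam], by rw [abs_of_neg h]; ring, ?_⟩
      filter_upwards [hlim.eventually_lt_const h] with τ hτ
      rw [abs_of_neg hτ, abs_of_neg h]; ring
    · refine ⟨lam * SignType.sign (d j), ?_, by simp [h], ?_⟩
      · rw [abs_mul, abs_of_nonneg hlam]
        refine mul_le_of_le_one_right hlam ?_
        rcases lt_trichotomy (d j) 0 with h | h | h <;> simp [h]
      · filter_upwards [self_mem_nhdsWithin] with τ hτ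
        rw [h, zero_add, abs_mul, abs_of_pos hτ, abs_zero, mul_assoc, sign_mul_self]
        ring
    · refine ⟨lam, by rw [abs_of_nonneg hlam], by rw [abs_of_pos h], ?_⟩
      filter_upwards [hlim.eventually_const_lt h] with τ hτ
      rw [abs_of_pos hτ, abs_of_pos h]; ring
  choose s hs1 hs2 hs3 using key
  refine ⟨s, ⟨hs1, hs2⟩, ?_⟩
  filter_upwards [eventually_all.2 hs3] with τ hτ
  simp only [Finset.mul_sum, ← Finset.sum_add_distrib]
  exact Finset.sum_congr rfl fun j _ => hτ j

/-! ### Minimisation of the fused objective on a subspace -/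

section Objective

variable {E J : Type*} [Fintype J] [NormedAddCommGroup E] [InnerProductSpace ℝ E]

/-- The function `x ↦ (c / 2) ‖y - x‖² + lam ∑ⱼ |⟪aⱼ, x⟫|`. -/
noncomputable def fusedObjective (a : J → E) (lam c : ℝ) (y x : E) : ℝ :=
  c / 2 * ‖y - x‖ ^ 2 + lam * ∑ j, |inner ℝ (a j) x|

theorem norm_le_of_isSymmetricProjection {P : E →ₗ[ℝ] E} (hP : P.IsSymmetricProjection) (x : E) :
    ‖P x‖ ≤ ‖x‖ := by
  have h1 : inner ℝ (P x) (P x) = inner ℝ x (P x) := by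
    rw [hP.isSymmetric x (P x), ← Module.End.mul_apply, hP.isIdempotentElem.eq]
  have h2 := real_inner_le_norm x (P x)
  rw [← h1, real_inner_self_eq_norm_sq] at h2
  by_contra! h
  nlinarith [norm_nonneg x]

theorem inner_sum_smul_eq (a : J → E) (s : J → ℝ) (d : E) :
    inner ℝ (Fintype.linearCombination ℝ a s) d = ∑ j, s j * inner ℝ (a j) d := by
  simp [Fintype.linearCombination_apply, sum_inner, inner_smul_left]

/-- A point satisfying the optimality condition on the subspace `P x = x` minimises the objective
there, with quadratic growth. -/
theorem fusedObjective_add_le {a : J → E} {lam c : ℝ} {y x z : E} {s : J → ℝ}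
    {P : E →ₗ[ℝ] E} (hP : P.IsSymmetricProjection)
    (hs : IsL1Subgrad lam (fun j => inner ℝ (a j) x) s)
    (hstat : P (Fintype.linearCombination ℝ a s) = P (c • (y - x))) (hx : P x = x)
    (hz : P z = z) :
    fusedObjective a lam c y x + c / 2 * ‖z - x‖ ^ 2 ≤ fusedObjective a lam c y z := by
  have hd : P (z - x) = z - x := by rw [map_sub, hx, hz]
  have h1 := hs.sum_mul_sub_le fun j => inner ℝ (a j) z
  simp only [← inner_sub_right] at h1
  rw [← inner_sum_smul_eq, ← hd, ← hP.isSymmetric, hstat, hP.isSymmetric, hd,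
    real_inner_smul_left] at h1
  have h2 : ‖y - z‖ ^ 2 = ‖y - x‖ ^ 2 - 2 * inner ℝ (y - x) (z - x) + ‖z - x‖ ^ 2 := by
    rw [← norm_sub_sq_real, sub_sub_sub_cancel_right]
  simp only [fusedObjective]
  rw [h2]
  linarith

theorem isSymmetricProjection_one : (1 : E →ₗ[ℝ] E).IsSymmetricProjection :=
  ⟨IsIdempotentElem.one, LinearMap.IsSymmetric.id⟩

variable [FiniteDimensional ℝ E]

theorem exists_isMinOn_fusedObjective (a : J → E) {lam c : ℝ} (hlam : 0 ≤ lam) (hc : 0 < c)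
    (y : E) (P : E →ₗ[ℝ] E) :
    ∃ x, P x = x ∧ ∀ z, P z = z → fusedObjective a lam c y x ≤ fusedObjective a lam c y z := by
  have hcont : Continuous (fusedObjective a lam c y) := by
    unfold fusedObjective; fun_prop
  have hcl : IsClosed {x | P x = x} :=
    isClosed_eq P.continuous_of_finiteDimensional continuous_id
  have hcoer : Tendsto (fusedObjective a lam c y) (cocompact E) atTop := by
    have h1 : Tendsto (fun x : E => ‖y - x‖) (cocompact E) atTop := by
      refine tendsto_atTop_mono (fun x => ?_)
        (tendsto_atTop_add_const_right _ (-‖y‖) (tendsto_norm_cocompact_atTop (E := E)))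
      rw [norm_sub_rev]
      linarith [norm_sub_norm_le x y]
    refine tendsto_atTop_mono (fun x => ?_)
      (((tendsto_pow_atTop two_ne_zero).comp h1).const_mul_atTop (half_pos hc))
    exact le_add_of_nonneg_right (mul_nonneg hlam (Finset.sum_nonneg fun _ _ => abs_nonneg _))
  obtain ⟨x, hx, hmin⟩ := hcont.continuousOn.exists_isMinOn' hcl (x₀ := 0) (map_zero P)
    ((hcoer.eventually_ge_atTop _).filter_mono inf_le_left)
  exact ⟨x, hx, fun z hz => hmin hz⟩

/-- First-order optimality on the subspace `P x = x`. If the projected gradient were outside the compact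
convex set of projected subgradients, a separating functional would give a feasible descent
direction. -/
theorem exists_isL1Subgrad_of_isMinOn {a : J → E} {lam c : ℝ} (hlam : 0 ≤ lam) {y x : E}
    {P : E →ₗ[ℝ] E} (hP : P.IsSymmetricProjection) (hx : P x = x)
    (hmin : ∀ z, P z = z → fusedObjective a lam c y x ≤ fusedObjective a lam c y z) :
    ∃ s, IsL1Subgrad lam (fun j => inner ℝ (a j) x) s ∧
      P (Fintype.linearCombination ℝ a s) = P (c • (y - x)) := by
  let B : (J → ℝ) →ₗ[ℝ] E := P ∘ₗ Fintype.linearCombination ℝ a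
  let S := {s | IsL1Subgrad lam (fun j => inner ℝ (a j) x) s}
  by_contra! hno
  have hnot : P (c • (y - x)) ∉ B '' S := by
    rintro ⟨s, hs, h⟩
    exact hno s hs h
  have hcl : IsClosed (B '' S) :=
    ((isCompact_setOf_isL1Subgrad lam _).image B.continuous_of_finiteDimensional).isClosed
  obtain ⟨f, u, hfu, huf⟩ := geometric_hahn_banach_closed_point
    ((convex_setOf_isL1Subgrad lam _).linear_image B) hcl hnot
  set d := P ((InnerProductSpace.toDual ℝ E).symm f) with hd
  have hfd : ∀ w, f (P w) = inner ℝ w d := fun w => by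
    rw [← InnerProductSpace.toDual_symm_apply, real_inner_comm, hP.isSymmetric]
  have hPd : P d = d := by rw [hd, ← Module.End.mul_apply, hP.isIdempotentElem.eq]
  obtain ⟨s, hs, hder⟩ := exists_isL1Subgrad_directional hlam (fun j => inner ℝ (a j) x)
    fun j => inner ℝ (a j) d
  have h1 : ∑ j, s j * inner ℝ (a j) d < c * inner ℝ (y - x) d := by
    have h2 := (hfu _ ⟨s, hs, rfl⟩).trans huf
    rw [hfd, real_inner_smul_left] at h2
    change f (P (Fintype.linearCombination ℝ a s)) < _ at h2
    rwa [hfd, inner_sum_smul_eq] at h2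
  -- Along the feasible direction `d` the objective has a negative one-sided derivative.
  have hlim : Tendsto (fun τ : ℝ => ∑ j, s j * inner ℝ (a j) d + τ * (c / 2 * ‖d‖ ^ 2)) (𝓝[>] 0)
      (𝓝 (∑ j, s j * inner ℝ (a j) d)) := by
    have : Continuous fun τ : ℝ => ∑ j, s j * inner ℝ (a j) d + τ * (c / 2 * ‖d‖ ^ 2) := by
      fun_prop
    simpa using (this.tendsto 0).mono_left nhdsWithin_le_nhds
  obtain ⟨τ, ⟨hτ, hτ1⟩, hτ0⟩ := ((hder.and (hlim.eventually_lt_const h1)).and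
    self_mem_nhdsWithin).exists
  have hτpos : 0 < τ := hτ0
  have h3 := hmin (x + τ • d) (by rw [map_add, map_smul, hx, hPd])
  have h4 : ‖y - (x + τ • d)‖ ^ 2 = ‖y - x‖ ^ 2 - 2 * (τ * inner ℝ (y - x) d) + τ ^ 2 * ‖d‖ ^ 2 := by
    rw [← sub_sub, norm_sub_sq_real, real_inner_smul_right, norm_smul, mul_pow, Real.norm_eq_abs,
      sq_abs]
  simp only [fusedObjective, inner_add_right, real_inner_smul_right, hτ, h4] at h3
  nlinarith

theorem existsUnique_isMinOn_fusedObjective (a : J → E) {lam c : ℝ} (hlam : 0 ≤ lam) (hc : 0 < c)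
    (y : E) {P : E →ₗ[ℝ] E} (hP : P.IsSymmetricProjection) :
    ∃! x, P x = x ∧ ∀ z, P z = z → fusedObjective a lam c y x ≤ fusedObjective a lam c y z := by
  obtain ⟨x, hx, hmin⟩ := exists_isMinOn_fusedObjective a hlam hc y P
  obtain ⟨s, hs, hstat⟩ := exists_isL1Subgrad_of_isMinOn hlam hP hx hmin
  refine ⟨x, ⟨hx, hmin⟩, fun z ⟨hz, hzmin⟩ => ?_⟩
  have h1 := fusedObjective_add_le hP hs hstat hx hz
  have h2 : ‖z - x‖ ^ 2 ≤ 0 := by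
    have h3 := hzmin x hx
    exact nonpos_of_mul_nonpos_right (by linarith : c / 2 * ‖z - x‖ ^ 2 ≤ 0) (half_pos hc)
  exact sub_eq_zero.1 (norm_eq_zero.1 (pow_eq_zero_iff two_ne_zero |>.1
    (le_antisymm h2 (sq_nonneg _))))

end Objective

/-! ### Fejér monotonicity, error bound and linear rate -/

section Residual

variable {E : Type*} [NormedAddCommGroup E] {ρ : ℝ}

/-- The decrease of the squared distance to a fixed point guaranteed by one pass of the ADMM; `θ` is
the value computed from `η` and `μ`, and `x` is the optimum. -/
noncomputable def admmResidual (ρ : ℝ) (x θ η μ : E) : ℝ :=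
  ‖θ - η‖ ^ 2 + ‖θ - μ‖ ^ 2 + 2 / ρ * ‖θ - x‖ ^ 2

theorem norm_le_sqrt_admmResidual (hρ : 0 < ρ) (x θ η μ : E) :
    ‖θ - η‖ ≤ √(admmResidual ρ x θ η μ) ∧ ‖θ - μ‖ ≤ √(admmResidual ρ x θ η μ) ∧
      ‖θ - x‖ ≤ √(ρ / 2) * √(admmResidual ρ x θ η μ) := by
  have h : 0 ≤ 2 / ρ * ‖θ - x‖ ^ 2 := by positivity
  have h1 := sq_nonneg ‖θ - η‖
  have h2 := sq_nonneg ‖θ - μ‖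
  refine ⟨Real.le_sqrt_of_sq_le (by unfold admmResidual; linarith),
    Real.le_sqrt_of_sq_le (by unfold admmResidual; linarith), ?_⟩
  rw [← Real.sqrt_mul (by positivity)]
  refine Real.le_sqrt_of_sq_le ?_
  have h3 : ‖θ - x‖ ^ 2 = ρ / 2 * (2 / ρ * ‖θ - x‖ ^ 2) := by field_simp
  rw [h3]
  exact mul_le_mul_of_nonneg_left (by unfold admmResidual; linarith) (by positivity)

theorem admmResidual_nonneg (hρ : 0 < ρ) (x θ η μ : E) : 0 ≤ admmResidual ρ x θ η μ := by
  unfold admmResidual; positivity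

end Residual

section Convergence

variable {E J : Type*} [Fintype J] [NormedAddCommGroup E] [InnerProductSpace ℝ E]

/-- The relations between `η, μ` and the scaled dual variables `u, v` after any pass of the ADMM:
`η` lies in the range of the projection `P`, `u` is orthogonal to it, and `ρ • v` is a subgradient
at `μ` of `lam ∑ⱼ |⟪aⱼ, ·⟫|`. -/
structure IsPrimalDualPair (a : J → E) (lam ρ : ℝ) (P : E →ₗ[ℝ] E) (η μ u v : E) : Prop where
  map_primal : P η = η
  map_dual : P u = 0
  exists_subgrad : ∃ s, IsL1Subgrad lam (fun j => inner ℝ (a j) μ) s ∧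
    Fintype.linearCombination ℝ a s = ρ • v

/-- The pairs of scaled dual variables that certify optimality of `x`. -/
def dualSolutions (a : J → E) (lam ρ : ℝ) (P : E →ₗ[ℝ] E) (y x : E) : Set (E × E) :=
  {w | IsPrimalDualPair a lam ρ P x x w.1 w.2 ∧ ρ • (w.1 + w.2) = y - x}

/-- Squared distance of the pair `(b, c)`, standing for `(η + u, μ + v)`, to the set of fixed points
`(x + w.1, x + w.2)`, where `w` runs over the dual solutions. -/
noncomputable def sqDistDual (a : J → E) (lam ρ : ℝ) (P : E →ₗ[ℝ] E) (y x b c : E) : ℝ :=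
  ⨅ w : dualSolutions a lam ρ P y x, (‖b - (x + w.1.1)‖ ^ 2 + ‖c - (x + w.1.2)‖ ^ 2)

variable {a : J → E} {lam ρ : ℝ} {P : E →ₗ[ℝ] E} {y x : E}

/-- One pass of the ADMM brings `(η + u, μ + v)` closer to every fixed point. As `η + u` is replaced by
`θ + u` and `μ + v` by `θ + v`, the left-hand side concerns the next iterate. Beyond the usual terms
of a firmly nonexpansive map, strong convexity of the quadratic contributes `(2 / ρ) ‖θ - x‖²`. -/
theorem admm_fejer (hρ : 0 < ρ) (hP : P.IsSymmetricProjection) {η μ u v θ : E}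
    (hpt : IsPrimalDualPair a lam ρ P η μ u v)
    (hθ : (2 * ρ + 1) • θ = y + ρ • (η - u + μ - v)) {w : E × E}
    (hw : w ∈ dualSolutions a lam ρ P y x) :
    ‖θ + u - (x + w.1)‖ ^ 2 + ‖θ + v - (x + w.2)‖ ^ 2 + admmResidual ρ x θ η μ ≤
      ‖η + u - (x + w.1)‖ ^ 2 + ‖μ + v - (x + w.2)‖ ^ 2 := by
  obtain ⟨hw1, hw2⟩ := hw
  have horth : inner ℝ (η - x) (u - w.1) = 0 := by
    have h1 : P (η - x) = η - x := by rw [map_sub, hpt.map_primal, hw1.map_primal]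
    rw [← h1, hP.isSymmetric, map_sub, hpt.map_dual, hw1.map_dual, sub_zero, inner_zero_right]
  have hmono : 0 ≤ inner ℝ (v - w.2) (μ - x) := by
    obtain ⟨s, hs, hsv⟩ := hpt.exists_subgrad
    obtain ⟨s', hs', hsv'⟩ := hw1.exists_subgrad
    have h1 := hs.monotone hs'
    simp only [← inner_sub_right] at h1
    have h2 := inner_sum_smul_eq a (s - s') (μ - x)
    simp only [Pi.sub_apply] at h2
    rw [← h2, map_sub, hsv, hsv', ← smul_sub, real_inner_smul_left] at h1
    exact nonneg_of_mul_nonneg_right h1 hρ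
  have heq : (2 * ρ + 1) • (θ - x) = ρ • ((η - x) - (u - w.1) + (μ - x) - (v - w.2)) := by
    have h1 : (2 * ρ + 1) • (θ - x) = (2 * ρ + 1) • θ - (2 * ρ + 1) • x := smul_sub _ _ _
    have h2 : y = ρ • (w.1 + w.2) + x := by rw [hw2]; abel
    rw [h1, hθ, h2]
    module
  have hin := congrArg (inner ℝ (θ - x)) heq
  simp only [real_inner_smul_right, inner_add_right, inner_sub_right (θ - x) _ (u - w.1),
    inner_sub_right (θ - x) _ (v - w.2), real_inner_self_eq_norm_sq] at hin
  have e1 : θ + u - (x + w.1) = (θ - x) + (u - w.1) := by abel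
  have e2 : θ + v - (x + w.2) = (θ - x) + (v - w.2) := by abel
  have e3 : η + u - (x + w.1) = (η - x) + (u - w.1) := by abel
  have e4 : μ + v - (x + w.2) = (μ - x) + (v - w.2) := by abel
  have e5 : θ - η = (θ - x) - (η - x) := by abel
  have e6 : θ - μ = (θ - x) - (μ - x) := by abel
  rw [real_inner_comm] at hmono
  unfold admmResidual
  rw [e1, e2, e3, e4, e5, e6, norm_add_sq_real (θ - x) (u - w.1),
    norm_add_sq_real (θ - x) (v - w.2), norm_add_sq_real (η - x) (u - w.1),
    norm_add_sq_real (μ - x) (v - w.2), norm_sub_sq_real (θ - x) (η - x),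
    norm_sub_sq_real (θ - x) (μ - x)]
  have hin' : inner ℝ (θ - x) (η - x) - inner ℝ (θ - x) (u - w.1) + inner ℝ (θ - x) (μ - x)
      - inner ℝ (θ - x) (v - w.2) = 2 * ‖θ - x‖ ^ 2 + 1 / ρ * ‖θ - x‖ ^ 2 := by
    field_simp
    linarith
  have h2ρ : 2 / ρ * ‖θ - x‖ ^ 2 = 2 * (1 / ρ * ‖θ - x‖ ^ 2) := by ring
  linarith

/-- Once the subdifferential at `μ` is contained in that at `x`, the squared distance to the set of
fixed points is at most a constant times the decrease in `admm_fejer`. The residual controls the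
primal errors and the sum of the dual errors directly; Hoffman's bound, applied to subgradients,
splits the latter between `u` and `v`. -/
theorem exists_dualSolutions_error_bound [FiniteDimensional ℝ E] (a : J → E) (lam : ℝ)
    (hρ : 0 < ρ) (hP : P.IsSymmetricProjection) (y x : E) :
    ∃ C : ℝ, 0 < C ∧ ∀ η μ u v θ : E, IsPrimalDualPair a lam ρ P η μ u v →
      (2 * ρ + 1) • θ = y + ρ • (η - u + μ - v) →
      (∀ s, IsL1Subgrad lam (fun j => inner ℝ (a j) μ) s →
        IsL1Subgrad lam (fun j => inner ℝ (a j) x) s) →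
      ∀ w ∈ dualSolutions a lam ρ P y x, ∃ w' ∈ dualSolutions a lam ρ P y x,
        ‖η + u - (x + w'.1)‖ ^ 2 + ‖μ + v - (x + w'.2)‖ ^ 2 ≤ C * admmResidual ρ x θ η μ := by
  let A : (J → ℝ) →ₗ[ℝ] E := Fintype.linearCombination ℝ a
  obtain ⟨κ, hκ, hhoff⟩ := exists_hoffman_bound_between (P ∘ₗ A)
  obtain ⟨α, hα, hA⟩ := (LinearMap.toContinuousLinearMap A).bound
  -- With `e` the root of the residual, `c₀ * e` bounds the error of `θ`, `c₁ * e` that of `u + v`, and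
  -- `c₂ * e` the distance from `v` to the nearby dual solution.
  set c₀ := √(ρ / 2) with hc₀
  have hc₀n : 0 ≤ c₀ := Real.sqrt_nonneg _
  set c₁ := 2 * (1 + c₀) + (2 + 1 / ρ) * c₀ with hc₁
  have hc₁n : 0 ≤ c₁ := by positivity
  set c₂ := α * κ * c₁ with hc₂
  have hc₂n : 0 ≤ c₂ := by positivity
  refine ⟨2 * (1 + c₀ + c₁ + c₂) ^ 2, by positivity, ?_⟩
  intro η μ u v θ hpt hθ hloc w ⟨hw1, hw2⟩
  obtain ⟨hr1, hr2, hr3⟩ := norm_le_sqrt_admmResidual hρ x θ η μ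
  set e := √(admmResidual ρ x θ η μ) with he
  have he0 : 0 ≤ e := Real.sqrt_nonneg _
  rw [← hc₀] at hr3
  have hη : ‖η - x‖ ≤ (1 + c₀) * e := by
    have : η - x = (θ - x) - (θ - η) := by abel
    rw [this]
    exact (norm_sub_le _ _).trans (by linarith)
  have hμ : ‖μ - x‖ ≤ (1 + c₀) * e := by
    have : μ - x = (θ - x) - (θ - μ) := by abel
    rw [this]
    exact (norm_sub_le _ _).trans (by linarith)
  have huv : ‖(u - w.1) + (v - w.2)‖ ≤ c₁ * e := by
    have h1 : (u - w.1) + (v - w.2) = (η - x) + (μ - x) - (2 + 1 / ρ) • (θ - x) := by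
      have h2 : θ = (2 * ρ + 1)⁻¹ • (y + ρ • (η - u + μ - v)) := by
        rw [← hθ, inv_smul_smul₀ (by positivity)]
      have h3 : ρ • ((u - w.1) + (v - w.2)) =
          ρ • ((η - x) + (μ - x) - (2 + 1 / ρ) • (θ - x)) := by
        have h4 : ρ • ((2 + 1 / ρ) • (θ - x)) = (2 * ρ + 1) • θ - (2 * ρ + 1) • x := by
          rw [smul_smul, ← smul_sub]
          congr 1
          field_simp
        have h5 : y = ρ • (w.1 + w.2) + x := by rw [hw2]; abel
        rw [smul_sub ρ _ ((2 + 1 / ρ) • (θ - x)), h4, hθ, h5]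
        module
      exact smul_right_injective E hρ.ne' h3
    rw [h1]
    refine (norm_sub_le _ _).trans ?_
    rw [norm_smul, Real.norm_of_nonneg (by positivity)]
    have h6 := norm_add_le (η - x) (μ - x)
    have h7 : (2 + 1 / ρ) * ‖θ - x‖ ≤ (2 + 1 / ρ) * (c₀ * e) :=
      mul_le_mul_of_nonneg_left hr3 (by positivity)
    rw [hc₁]
    linarith
  obtain ⟨s, hs, hsv⟩ := hpt.exists_subgrad
  obtain ⟨t, ht, htw⟩ := hw1.exists_subgrad
  obtain ⟨t', ht', hPt, hnorm⟩ := hhoff s t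
  have ht'sub := (hloc s hs).of_mem_uIcc ht ht'
  change P (A t') = P (A t) at hPt
  have hAt' : ρ • ρ⁻¹ • A t' = A t' := smul_inv_smul₀ hρ.ne' _
  -- `P` annihilates `u` and `w.1`, so the Hoffman residual is controlled by the sum of the duals.
  have hres : ‖P (A t) - P (A s)‖ ≤ ρ * (c₁ * e) := by
    have h1 : P (A t) - P (A s) = -(ρ • P ((u - w.1) + (v - w.2))) := by
      change Fintype.linearCombination ℝ a s = _ at hsv
      rw [show A t = ρ • w.2 from htw, show A s = ρ • v from hsv]
      simp only [map_smul, map_add, map_sub, hpt.map_dual, hw1.map_dual]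
      module
    rw [h1, norm_neg, norm_smul, Real.norm_of_nonneg hρ.le]
    exact mul_le_mul_of_nonneg_left ((norm_le_of_isSymmetricProjection hP _).trans huv) hρ.le
  have hv : ‖v - ρ⁻¹ • A t'‖ ≤ c₂ * e := by
    have h1 : v - ρ⁻¹ • A t' = -(ρ⁻¹ • A (t' - s)) := by
      rw [map_sub, show A s = ρ • v from hsv, smul_sub, inv_smul_smul₀ hρ.ne']
      abel
    rw [h1, norm_neg, norm_smul, Real.norm_of_nonneg (inv_nonneg.2 hρ.le)]
    have h2 : ‖A (t' - s)‖ ≤ α * (κ * (ρ * (c₁ * e))) :=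
      (hA _).trans (mul_le_mul_of_nonneg_left
        (hnorm.trans (mul_le_mul_of_nonneg_left hres hκ)) hα.le)
    calc ρ⁻¹ * ‖A (t' - s)‖ ≤ ρ⁻¹ * (α * (κ * (ρ * (c₁ * e)))) := by gcongr
      _ = c₂ * e := by rw [hc₂]; field_simp
  refine ⟨(w.1 + w.2 - ρ⁻¹ • A t', ρ⁻¹ • A t'),
    ⟨⟨hw1.map_primal, ?_, t', ht'sub, hAt'.symm⟩, by simpa using hw2⟩, ?_⟩
  · have h1 : P (ρ⁻¹ • A t') = P w.2 := by
      rw [map_smul, hPt, show A t = ρ • w.2 from htw, map_smul, inv_smul_smul₀ hρ.ne']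
    simp only [map_sub, map_add, h1, hw1.map_dual]
    abel
  · have h1 : ‖η + u - (x + (w.1 + w.2 - ρ⁻¹ • A t'))‖ ≤ (1 + c₀ + c₁ + c₂) * e := by
      have h2 : η + u - (x + (w.1 + w.2 - ρ⁻¹ • A t')) =
          (η - x) + ((u - w.1) + (v - w.2)) - (v - ρ⁻¹ • A t') := by abel
      rw [h2]
      have h3 := norm_sub_le ((η - x) + ((u - w.1) + (v - w.2))) (v - ρ⁻¹ • A t')
      have h4 := norm_add_le (η - x) ((u - w.1) + (v - w.2))
      linarith
    have h2 : ‖μ + v - (x + ρ⁻¹ • A t')‖ ≤ (1 + c₀ + c₁ + c₂) * e := by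
      have h3 : μ + v - (x + ρ⁻¹ • A t') = (μ - x) + (v - ρ⁻¹ • A t') := by abel
      rw [h3]
      have h4 := norm_add_le (μ - x) (v - ρ⁻¹ • A t')
      have h5 : 0 ≤ c₁ * e := mul_nonneg hc₁n he0
      linarith
    have h3 := pow_le_pow_left₀ (norm_nonneg _) h1 2
    have h4 := pow_le_pow_left₀ (norm_nonneg _) h2 2
    have h5 : e ^ 2 = admmResidual ρ x θ η μ := Real.sq_sqrt (admmResidual_nonneg hρ _ _ _ _)
    rw [mul_pow, h5] at h3 h4
    linarith

theorem sqDistDual_le {w : E × E} (hw : w ∈ dualSolutions a lam ρ P y x) (b c : E) :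
    sqDistDual a lam ρ P y x b c ≤ ‖b - (x + w.1)‖ ^ 2 + ‖c - (x + w.2)‖ ^ 2 :=
  ciInf_le (f := fun w : dualSolutions a lam ρ P y x =>
    ‖b - (x + w.1.1)‖ ^ 2 + ‖c - (x + w.1.2)‖ ^ 2)
    ⟨0, by rintro _ ⟨w, rfl⟩; positivity⟩ ⟨w, hw⟩

theorem sqDistDual_nonneg (b c : E) : 0 ≤ sqDistDual a lam ρ P y x b c :=
  Real.iInf_nonneg fun _ => by positivity

/-- Linear convergence of the ADMM in an abstract Euclidean space, for sequences in which `θ k` is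
computed from `η k, μ k, u k, v k`. The rate depends only on the constant of the error bound; the
initialization enters through the index `K` after which `μ k` is close enough to `x`. -/
theorem exists_linear_rate_of_dualSolutions_nonempty [FiniteDimensional ℝ E] (a : J → E)
    (lam : ℝ) (hρ : 0 < ρ) (hP : P.IsSymmetricProjection) {y x : E}
    (hne : (dualSolutions a lam ρ P y x).Nonempty) :
    ∃ q : ℝ, 0 < q ∧ q < 1 ∧ ∀ θ η μ u v : ℕ → E,
      (∀ k, IsPrimalDualPair a lam ρ P (η k) (μ k) (u k) (v k)) →
      (∀ k, (2 * ρ + 1) • θ k = y + ρ • (η k - u k + μ k - v k)) →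
      (∀ k, η (k + 1) + u (k + 1) = θ k + u k) → (∀ k, μ (k + 1) + v (k + 1) = θ k + v k) →
      ∃ (K : ℕ) (C : ℝ), ∀ k, ‖θ (k + K) - x‖ ≤ C * q ^ k ∧ ‖η (k + K) - x‖ ≤ C * q ^ k ∧
        ‖μ (k + K) - x‖ ≤ C * q ^ k := by
  obtain ⟨C, hC, hbound⟩ := exists_dualSolutions_error_bound a lam hρ hP y x
  set r := 1 - (C + 1)⁻¹ with hr
  have hr0 : 0 < r := sub_pos.2 (inv_lt_one_of_one_lt₀ (by linarith))
  have hr1 : r < 1 := sub_lt_self _ (by positivity)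
  refine ⟨√r, Real.sqrt_pos.2 hr0, (Real.sqrt_lt' one_pos).2 (by simpa using hr1), ?_⟩
  intro θ η μ u v hpt hθ hu hv
  set δ : ℕ → ℝ := fun k => admmResidual ρ x (θ k) (η k) (μ k) with hδ
  have hδ0 : ∀ k, 0 ≤ δ k := fun k => admmResidual_nonneg hρ _ _ _ _
  have hfejer : ∀ w ∈ dualSolutions a lam ρ P y x, ∀ k,
      ‖η (k + 1) + u (k + 1) - (x + w.1)‖ ^ 2 + ‖μ (k + 1) + v (k + 1) - (x + w.2)‖ ^ 2 + δ k ≤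
        ‖η k + u k - (x + w.1)‖ ^ 2 + ‖μ k + v k - (x + w.2)‖ ^ 2 := by
    intro w hw k
    rw [hu, hv]
    exact admm_fejer hρ hP (hpt k) (hθ k) hw
  -- The residuals are summable, so `μ` converges to `x` and the error bound eventually applies.
  have hδlim : Tendsto δ atTop (𝓝 0) := by
    obtain ⟨w, hw⟩ := hne
    set f : ℕ → ℝ := fun k => ‖η k + u k - (x + w.1)‖ ^ 2 + ‖μ k + v k - (x + w.2)‖ ^ 2
    have hanti : Antitone f := antitone_nat_of_succ_le fun k => by
      linarith [hfejer w hw k, hδ0 k]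
    have hlim := tendsto_atTop_ciInf hanti ⟨0, by rintro _ ⟨k, rfl⟩; positivity⟩
    have hdiff := hlim.sub (hlim.comp (tendsto_add_atTop_nat 1))
    rw [sub_self] at hdiff
    exact squeeze_zero hδ0 (fun k => by
      simp only [Function.comp_apply]; linarith [hfejer w hw k]) hdiff
  have hprimal : ∀ k, ‖θ k - x‖ ≤ (1 + √(ρ / 2)) * √(δ k) ∧
      ‖η k - x‖ ≤ (1 + √(ρ / 2)) * √(δ k) ∧ ‖μ k - x‖ ≤ (1 + √(ρ / 2)) * √(δ k) := by
    intro k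
    obtain ⟨h1, h2, h3⟩ := norm_le_sqrt_admmResidual hρ x (θ k) (η k) (μ k)
    have h4 : 0 ≤ √(δ k) := Real.sqrt_nonneg _
    change _ ≤ √(δ k) at h1
    change _ ≤ √(δ k) at h2
    change _ ≤ _ * √(δ k) at h3
    refine ⟨by linarith, ?_, ?_⟩
    · rw [show η k - x = (θ k - x) - (θ k - η k) by abel]
      exact (norm_sub_le _ _).trans (by linarith)
    · rw [show μ k - x = (θ k - x) - (θ k - μ k) by abel]
      exact (norm_sub_le _ _).trans (by linarith)
  have hμlim : Tendsto μ atTop (𝓝 x) := by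
    rw [tendsto_iff_norm_sub_tendsto_zero]
    have h1 := (hδlim.sqrt).const_mul (1 + √(ρ / 2))
    rw [Real.sqrt_zero, mul_zero] at h1
    exact squeeze_zero (fun _ => norm_nonneg _) (fun k => (hprimal k).2.2) h1
  have hloc : ∀ᶠ k in atTop, ∀ s, IsL1Subgrad lam (fun j => inner ℝ (a j) (μ k)) s →
      IsL1Subgrad lam (fun j => inner ℝ (a j) x) s := by
    have hc : Continuous fun z : E => fun j => (inner ℝ (a j) z : ℝ) := by fun_prop
    exact ((hc.tendsto x).comp hμlim).eventually (IsL1Subgrad.eventually_of_near lam _)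
  obtain ⟨K, hK⟩ := eventually_atTop.1 hloc
  set d : ℕ → ℝ := fun k => sqDistDual a lam ρ P y x (η k + u k) (μ k + v k) with hd
  have hdec : ∀ k, d (k + 1) + δ k ≤ d k := fun k => by
    have : Nonempty (dualSolutions a lam ρ P y x) := hne.to_subtype
    refine le_ciInf fun w => ?_
    linarith [hfejer w.1 w.2 k, sqDistDual_le w.2 (η (k + 1) + u (k + 1)) (μ (k + 1) + v (k + 1))]
  have herr : ∀ k, K ≤ k → d k ≤ C * δ k := fun k hk => by
    obtain ⟨w, hw⟩ := hne
    obtain ⟨w', hw', h⟩ := hbound _ _ _ _ _ (hpt k) (hθ k) (hK k hk) w hw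
    exact (sqDistDual_le hw' _ _).trans h
  have hcontr : ∀ k, d (k + K) ≤ d K * r ^ k := by
    intro k
    induction k with
    | zero => simp
    | succ k ih =>
      have h1 : d (k + K) ≤ (C + 1) * δ (k + K) :=
        (herr _ (Nat.le_add_left K k)).trans (by linarith [hδ0 (k + K)])
      have h2 : (C + 1)⁻¹ * d (k + K) ≤ δ (k + K) := by
        rw [inv_mul_le_iff₀ (by positivity)]; exact h1
      have h3 := hdec (k + K)
      rw [show k + 1 + K = k + K + 1 by ring]
      calc d (k + K + 1) ≤ r * d (k + K) := by rw [hr]; linarith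
        _ ≤ r * (d K * r ^ k) := by gcongr
        _ = d K * r ^ (k + 1) := by ring
  refine ⟨K, (1 + √(ρ / 2)) * √(d K), fun k => ?_⟩
  have hsq : √(δ (k + K)) ≤ √(d K) * √r ^ k := by
    have h1 : δ (k + K) ≤ d K * r ^ k := by
      have h2 : 0 ≤ d (k + K + 1) := sqDistDual_nonneg _ _
      linarith [hdec (k + K), hcontr k]
    refine Real.sqrt_le_iff.2 ⟨by positivity, h1.trans_eq ?_⟩
    rw [mul_pow, Real.sq_sqrt (sqDistDual_nonneg _ _), ← pow_mul, mul_comm k 2, pow_mul,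
      Real.sq_sqrt hr0.le]
  have hfin : (1 + √(ρ / 2)) * √(δ (k + K)) ≤ (1 + √(ρ / 2)) * √(d K) * √r ^ k := by
    rw [mul_assoc]; gcongr
  obtain ⟨h1, h2, h3⟩ := hprimal (k + K)
  exact ⟨h1.trans hfin, h2.trans hfin, h3.trans hfin⟩

end Convergence

/-! ### The graph-fused problem in matrix form -/

theorem l2norm_eq_norm {ι : Type*} [Fintype ι] (x : ι → ℝ) : l2norm x = ‖WithLp.toLp 2 x‖ := by
  simp [l2norm, EuclideanSpace.norm_eq]

theorem hat_mul_hat {n p : ℕ} {X : Matrix (Fin n) (Fin p) ℝ} (hX : X.rank = p) :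
    hat X * hat X = hat X := by
  have hunit : IsUnit (Xᵀ * X).det := by
    rw [← Matrix.isUnit_iff_isUnit_det, ← Matrix.mulVec_surjective_iff_isUnit]
    have hrank : (Xᵀ * X).rank = p := by rw [Matrix.rank_transpose_mul_self, hX]
    exact LinearMap.range_eq_top.1
      (Submodule.eq_top_of_finrank_eq (S := LinearMap.range (Xᵀ * X).mulVecLin)
        (hrank.trans (Module.finrank_fin_fun ℝ).symm))
  unfold hat
  calc X * (Xᵀ * X)⁻¹ * Xᵀ * (X * (Xᵀ * X)⁻¹ * Xᵀ)
      = X * ((Xᵀ * X)⁻¹ * (Xᵀ * X)) * (Xᵀ * X)⁻¹ * Xᵀ := by simp only [Matrix.mul_assoc]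
    _ = X * (Xᵀ * X)⁻¹ * Xᵀ := by rw [Matrix.nonsing_inv_mul _ hunit, Matrix.mul_one]

theorem transpose_hat {n p : ℕ} (X : Matrix (Fin n) (Fin p) ℝ) : (hat X)ᵀ = hat X := by
  simp [hat, Matrix.transpose_mul, Matrix.transpose_nonsing_inv, Matrix.mul_assoc]

theorem isSymmetricProjection_extHat {n p : ℕ} (M : ℕ) {X : Matrix (Fin n) (Fin p) ℝ}
    (hX : X.rank = p) : (Matrix.toEuclideanLin (extHat M X)).IsSymmetricProjection := by
  constructor
  · have h : extHat M X * extHat M X = extHat M X := by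
      rw [extHat, ← Matrix.mul_kronecker_mul, hat_mul_hat hX, Matrix.one_mul]
    ext1 x
    rw [Module.End.mul_apply]
    simp [Matrix.toLpLin_apply, Matrix.mulVec_mulVec, h]
  · rw [Matrix.isSymmetric_toEuclideanLin_iff]
    change (extHat M X)ᴴ = _
    rw [extHat, Matrix.conjTranspose_kronecker, Matrix.conjTranspose_one,
      Matrix.conjTranspose_eq_transpose_of_trivial, transpose_hat]

theorem mem_feasibleCP_iff {n p M : ℕ} {X : Matrix (Fin n) (Fin p) ℝ} (θ : Fin n × Fin M → ℝ) :
    θ ∈ feasibleCP M X ↔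
      Matrix.toEuclideanLin (extHat M X) (WithLp.toLp 2 θ) = WithLp.toLp 2 θ := by
  rw [Matrix.toLpLin_toLp, (WithLp.toLp_injective 2).eq_iff]
  change (1 - extHat M X) *ᵥ θ = 0 ↔ _
  rw [Matrix.sub_mulVec, Matrix.one_mulVec, sub_eq_zero, eq_comm]
  rfl

/-- The column `j` of the extended incidence matrix, as a vector of the Euclidean space. -/
noncomputable def edgeVector (n : ℕ) {M m : ℕ} {G : SimpleGraph (Fin M)} (e : Fin m ≃ G.edgeSet)
    (j : Fin n × Fin m) : EuclideanSpace ℝ (Fin n × Fin M) :=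
  WithLp.toLp 2 fun i => extIncidence n e i j

section Transfer

variable {n p M m : ℕ} {X : Matrix (Fin n) (Fin p) ℝ} {Y : Matrix (Fin n) (Fin M) ℝ}
  {G : SimpleGraph (Fin M)} {e : Fin m ≃ G.edgeSet} {lam ρ : ℝ}

theorem inner_edgeVector (θ : Fin n × Fin M → ℝ) (j : Fin n × Fin m) :
    inner ℝ (edgeVector n e j) (WithLp.toLp 2 θ) = ((extIncidence n e)ᵀ *ᵥ θ) j := by
  simp [edgeVector, PiLp.inner_apply, Matrix.mulVec, dotProduct, mul_comm]

theorem objCP_eq (θ : Fin n × Fin M → ℝ) : objCP Y e lam θ =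
    fusedObjective (edgeVector n e) lam 1 (WithLp.toLp 2 Yᵀ.vec) (WithLp.toLp 2 θ) := by
  simp only [objCP, fusedObjective, l1norm, inner_edgeVector, l2norm_eq_norm, WithLp.toLp_sub]

theorem objGFL_eq (w μ : Fin n × Fin M → ℝ) : objGFL e lam ρ w μ =
    fusedObjective (edgeVector n e) lam ρ (WithLp.toLp 2 w) (WithLp.toLp 2 μ) := by
  simp only [objGFL, fusedObjective, l1norm, inner_edgeVector, l2norm_eq_norm, WithLp.toLp_sub,
    add_comm]

theorem isOptimumCP_iff (θ : Fin n × Fin M → ℝ) : IsOptimumCP X Y e lam θ ↔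
    Matrix.toEuclideanLin (extHat M X) (WithLp.toLp 2 θ) = WithLp.toLp 2 θ ∧
      ∀ z, Matrix.toEuclideanLin (extHat M X) z = z →
        fusedObjective (edgeVector n e) lam 1 (WithLp.toLp 2 Yᵀ.vec) (WithLp.toLp 2 θ) ≤
          fusedObjective (edgeVector n e) lam 1 (WithLp.toLp 2 Yᵀ.vec) z := by
  rw [IsOptimumCP, mem_feasibleCP_iff, isMinOn_iff]
  refine and_congr_right fun _ => ⟨fun h z hz => ?_, fun h z hz => ?_⟩
  · have := h z.ofLp ((mem_feasibleCP_iff _).2 hz)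
    rwa [objCP_eq, objCP_eq] at this
  · rw [objCP_eq, objCP_eq]
    exact h _ ((mem_feasibleCP_iff _).1 hz)

theorem isMinOn_objGFL_iff (w μ : Fin n × Fin M → ℝ) :
    IsMinOn (objGFL e lam ρ w) Set.univ μ ↔
      ∀ z, fusedObjective (edgeVector n e) lam ρ (WithLp.toLp 2 w) (WithLp.toLp 2 μ) ≤
        fusedObjective (edgeVector n e) lam ρ (WithLp.toLp 2 w) z := by
  rw [isMinOn_univ_iff]
  simp only [objGFL_eq]
  exact ⟨fun h z => h z.ofLp, fun h z => h _⟩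

theorem existsUnique_isMinOn_objGFL (e : Fin m ≃ G.edgeSet) (hlam : 0 ≤ lam) (hρ : 0 < ρ)
    (w : Fin n × Fin M → ℝ) : ∃! μ, IsMinOn (objGFL e lam ρ w) Set.univ μ := by
  obtain ⟨μ, ⟨-, hμ⟩, huniq⟩ := existsUnique_isMinOn_fusedObjective (edgeVector n e) hlam hρ
    (WithLp.toLp 2 w) isSymmetricProjection_one
  refine ⟨μ.ofLp, (isMinOn_objGFL_iff _ _).2 fun z => hμ z rfl, fun ν hν => ?_⟩
  rw [← huniq (WithLp.toLp 2 ν) ⟨rfl, fun z _ => (isMinOn_objGFL_iff _ _).1 hν z⟩]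

theorem existsUnique_admmStep (X : Matrix (Fin n) (Fin p) ℝ) (Y : Matrix (Fin n) (Fin M) ℝ)
    (e : Fin m ≃ G.edgeSet) (hlam : 0 ≤ lam) (hρ : 0 < ρ) (s : ADMMState n M) :
    ∃! t, ADMMStep X Y e lam ρ s t := by
  set θ := (2 * ρ + 1)⁻¹ • (Yᵀ.vec + ρ • (s.η - s.U + s.μ - s.V)) with hθ
  set η := extHat M X *ᵥ (θ + s.U) with hη
  obtain ⟨μ, hμ, huniq⟩ := existsUnique_isMinOn_objGFL e hlam hρ (θ + s.V)
  refine ⟨⟨θ, η, μ, s.U + θ - η, s.V + θ - μ⟩, ⟨hθ, hη, hμ, rfl, rfl⟩, fun t ht => ?_⟩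
  have h1 : t.θ = θ := ht.theta_eq
  have h2 : t.η = η := by rw [ht.eta_eq, h1]
  have h3 : t.μ = μ := huniq _ (by rw [← h1]; exact ht.mu_isMin)
  ext1
  exacts [h1, h2, h3, by rw [ht.U_eq, h1, h2], by rw [ht.V_eq, h1, h3]]

theorem existsUnique_isADMMRun (X : Matrix (Fin n) (Fin p) ℝ) (Y : Matrix (Fin n) (Fin M) ℝ)
    (e : Fin m ≃ G.edgeSet) (hlam : 0 ≤ lam) (hρ : 0 < ρ) (θ₀ η₀ μ₀ : Fin n × Fin M → ℝ) :
    ∃! s : ℕ → ADMMState n M, IsADMMRun X Y e lam ρ θ₀ η₀ μ₀ s := by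
  choose F hF huniq using fun s => existsUnique_admmStep X Y e hlam hρ s
  refine ⟨fun k => F^[k] ⟨θ₀, η₀, μ₀, 0, 0⟩, ⟨rfl, fun k => ?_⟩, fun s hs => funext fun k => ?_⟩
  · simp only [Function.iterate_succ_apply']
    exact hF _
  · induction k with
    | zero => exact hs.init
    | succ k ih => rw [Function.iterate_succ_apply', ← ih]; exact huniq _ _ (hs.step k)

theorem ADMMStep.isPrimalDualPair (hX : X.rank = p) (hlam : 0 ≤ lam)
    {s t : ADMMState n M} (h : ADMMStep X Y e lam ρ s t) :
    IsPrimalDualPair (edgeVector n e) lam ρ (Matrix.toEuclideanLin (extHat M X))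
      (WithLp.toLp 2 t.η) (WithLp.toLp 2 t.μ) (WithLp.toLp 2 t.U) (WithLp.toLp 2 t.V) := by
  have hP := isSymmetricProjection_extHat M hX
  set P := Matrix.toEuclideanLin (extHat M X) with hPdef
  have hη : WithLp.toLp 2 t.η = P (WithLp.toLp 2 (t.θ + s.U)) := by
    rw [hPdef, Matrix.toLpLin_toLp, h.eta_eq]; rfl
  have hPη : P (WithLp.toLp 2 t.η) = WithLp.toLp 2 t.η := by
    rw [hη, ← Module.End.mul_apply, hP.isIdempotentElem.eq]
  refine ⟨hPη, ?_, ?_⟩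
  · have hU : t.U = (t.θ + s.U) - t.η := by rw [h.U_eq]; abel
    rw [hU, WithLp.toLp_sub, map_sub, hPη, hη, sub_self]
  · obtain ⟨r, hr, hstat⟩ := exists_isL1Subgrad_of_isMinOn hlam isSymmetricProjection_one rfl
      fun z _ => (isMinOn_objGFL_iff _ _).1 h.mu_isMin z
    refine ⟨r, hr, ?_⟩
    have hV : t.V = (t.θ + s.V) - t.μ := by rw [h.V_eq]; abel
    rw [hV, WithLp.toLp_sub]
    exact hstat

end Transfer

/-- A geometric bound on a tail extends to the whole sequence, with a larger constant. -/
theorem exists_geometric_bound_of_shift {f : ℕ → ℝ} {q C : ℝ} (hq : 0 < q) (K : ℕ)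
    (h : ∀ k, f (k + K) ≤ C * q ^ k) : ∃ C' : ℝ, ∀ k, f k ≤ C' * q ^ k := by
  have hsum : 0 ≤ ∑ i ∈ Finset.range K, |f i| / q ^ i := Finset.sum_nonneg fun _ _ => by positivity
  refine ⟨(∑ i ∈ Finset.range K, |f i| / q ^ i) + |C| / q ^ K, fun k => ?_⟩
  rcases lt_or_ge k K with hk | hk
  · have h1 : |f k| / q ^ k ≤ ∑ i ∈ Finset.range K, |f i| / q ^ i :=
      Finset.single_le_sum (f := fun i => |f i| / q ^ i) (fun _ _ => by positivity)
        (Finset.mem_range.2 hk)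
    have h2 : 0 ≤ |C| / q ^ K := by positivity
    calc f k ≤ |f k| / q ^ k * q ^ k := by
          rw [div_mul_cancel₀ _ (by positivity)]; exact le_abs_self _
      _ ≤ _ := by gcongr; linarith
  · obtain ⟨i, rfl⟩ := Nat.exists_eq_add_of_le' hk
    calc f (i + K) ≤ |C| * q ^ i := (h i).trans (by gcongr; exact le_abs_self C)
      _ = |C| / q ^ K * q ^ (i + K) := by rw [pow_add]; field_simp
      _ ≤ _ := by gcongr; linarith

theorem theoremB (n p M m : ℕ) (X : Matrix (Fin n) (Fin p) ℝ) (hX : X.rank = p)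
    (Y : Matrix (Fin n) (Fin M) ℝ) (G : SimpleGraph (Fin M)) (e : Fin m ≃ G.edgeSet)
    (lam ρ : ℝ) (hlam : 0 ≤ lam) (hρ : 0 < ρ) :
    ∃ θhat : Fin n × Fin M → ℝ,
      IsOptimumCP X Y e lam θhat ∧
      (∀ θ : Fin n × Fin M → ℝ, IsOptimumCP X Y e lam θ → θ = θhat) ∧
      ∃ q : ℝ, 0 < q ∧ q < 1 ∧
        ∀ θ₀ η₀ μ₀ : Fin n × Fin M → ℝ,
          (∃! s : ℕ → ADMMState n M, IsADMMRun X Y e lam ρ θ₀ η₀ μ₀ s) ∧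
          ∀ s : ℕ → ADMMState n M, IsADMMRun X Y e lam ρ θ₀ η₀ μ₀ s →
            ∃ C : ℝ, ∀ k : ℕ,
              l2norm ((s k).θ - θhat) ≤ C * q ^ k ∧
              l2norm ((s k).η - θhat) ≤ C * q ^ k ∧
              l2norm ((s k).μ - θhat) ≤ C * q ^ k := by
  have hP := isSymmetricProjection_extHat M hX
  obtain ⟨x, ⟨hx, hmin⟩, huniq⟩ := existsUnique_isMinOn_fusedObjective (edgeVector n e) hlam
    one_pos (WithLp.toLp 2 Yᵀ.vec) hP
  obtain ⟨r, hr, hstat⟩ := exists_isL1Subgrad_of_isMinOn hlam hP hx hmin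
  rw [one_smul] at hstat
  have hne : (dualSolutions (edgeVector n e) lam ρ (Matrix.toEuclideanLin (extHat M X))
      (WithLp.toLp 2 Yᵀ.vec) x).Nonempty := by
    set A := Fintype.linearCombination ℝ (edgeVector n e) r with hA
    refine ⟨(ρ⁻¹ • (WithLp.toLp 2 Yᵀ.vec - x - A), ρ⁻¹ • A), ⟨hx, ?_, r, hr, ?_⟩, ?_⟩
    · rw [map_smul, map_sub _ _ A, hstat, sub_self, smul_zero]
    · exact (smul_inv_smul₀ hρ.ne' _).symm
    · rw [← smul_add, smul_inv_smul₀ hρ.ne', sub_add_cancel]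
  obtain ⟨q, hq0, hq1, hrate⟩ := exists_linear_rate_of_dualSolutions_nonempty _ lam hρ hP hne
  refine ⟨x.ofLp, (isOptimumCP_iff _).2 ⟨hx, hmin⟩, fun θ hθ => ?_, q, hq0, hq1,
    fun θ₀ η₀ μ₀ => ⟨existsUnique_isADMMRun X Y e hlam hρ θ₀ η₀ μ₀, fun s hs => ?_⟩⟩
  · rw [← huniq _ ((isOptimumCP_iff θ).1 hθ)]
  -- The initial state need not satisfy the primal-dual relations, so the sequences start after one
  -- pass; `θ` is shifted once more because it is computed from the previous `η, μ, U, V`.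
  obtain ⟨K, C, hC⟩ := hrate (fun k => WithLp.toLp 2 (s (k + 2)).θ)
    (fun k => WithLp.toLp 2 (s (k + 1)).η) (fun k => WithLp.toLp 2 (s (k + 1)).μ)
    (fun k => WithLp.toLp 2 (s (k + 1)).U) (fun k => WithLp.toLp 2 (s (k + 1)).V)
    (fun k => (hs.step k).isPrimalDualPair hX hlam)
    (fun k => by
      rw [(hs.step (k + 1)).theta_eq, WithLp.toLp_smul, smul_inv_smul₀ (by positivity)]
      rfl)
    (fun k => by
      rw [← WithLp.toLp_add, ← WithLp.toLp_add, (hs.step (k + 1)).U_eq]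
      congr 1; abel)
    (fun k => by
      rw [← WithLp.toLp_add, ← WithLp.toLp_add, (hs.step (k + 1)).V_eq]
      congr 1; abel)
  have hnorm : ∀ z, l2norm (z - x.ofLp) = ‖WithLp.toLp 2 z - x‖ := fun z => by
    rw [l2norm_eq_norm, WithLp.toLp_sub]
  simp only [hnorm]
  obtain ⟨C₁, h1⟩ := exists_geometric_bound_of_shift (f := fun k => ‖WithLp.toLp 2 (s k).θ - x‖)
    hq0 (K + 2) fun k => (hC k).1
  obtain ⟨C₂, h2⟩ := exists_geometric_bound_of_shift (f := fun k => ‖WithLp.toLp 2 (s k).η - x‖)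
    hq0 (K + 1) fun k => (hC k).2.1
  obtain ⟨C₃, h3⟩ := exists_geometric_bound_of_shift (f := fun k => ‖WithLp.toLp 2 (s k).μ - x‖)
    hq0 (K + 1) fun k => (hC k).2.2
  refine ⟨max C₁ (max C₂ C₃), fun k => ⟨(h1 k).trans ?_, (h2 k).trans ?_, (h3 k).trans ?_⟩⟩ <;>
    gcongr <;> simp
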